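/- Let $h>0$, let $\mathbb H_h=\{\omega\in\mathbb C:\operatorname{Im}\omega>-h\}$, and let $H(\mathbb H_h)$ be the space of analytic functions on $\mathbb H_h$ with the topology of locally uniform convergence (uniform convergence on compact subsets of $\mathbb H_h$). Let $\mathcal K_h$ be the set of all $f\in H(\mathbb H_h)$ such that - (S) $\overline{f(\omega)}=f(-\overline{\omega})$ for all $\omega\in\mathbb H_h$; - (P) $\operatorname{Im} f(\omega)>0$ for all $\omega\in\mathbb H_h$ with $\operatorname{Re}\omega>0$; - (L) there is $A>0$ such that $f(\omega)=-A\omega^{-2}+O(\omega^{-3})$ as $\omega\to\infty$ in $\mathbb H_h$. A Stieltjes function is either a nonnegative constant, or a non-constant function $F$ that is analytic in the open upper half-plane with $\operatorname{Im}F>0$ there, and that is analytic on the negative real axis, where it takes real nonnegative values; such an $F$ is extended analytically to $\mathbb C\setminus[0,\infty)$ by $F(\overline z)=\overline{F(z)}$. Let $$\mathcal S_h=\{f\in H(\mathbb H_h): f(\omega)=F((\omega+ih)^2)\text{ for all }\omega\in\mathbb H_h,\ F\text{ a Stieltjes function}\}.$$ Then: (i) The closure of $\mathcal K_h$ in $H(\mathbb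 H_h)$ is $\mathcal S_h$. (ii) For every $M>0$ the family $\mathcal S_h^M=\{f\in\mathcal S_h:\|f\|_{L^2(0,1)}\le M\}$ is normal, that is, every sequence in $\mathcal S_h^M$ has a subsequence that converges in $H(\mathbb H_h)$. -/

import Mathlib

open Filter Topology Asymptotics MeasureTheory
open scoped ComplexConjugate

namespace Permittivity

/-- The space `H(G)` of analytic functions on `G ⊆ ℂ`. As a subtype of `C(G, ℂ)` it carries the
compact-open topology, which for open `G` is the topology of locally uniform convergence, i.e. of
uniform convergence on compact subsets of `G`. -/
abbrev HolSpace (G : Set ℂ) : Type :=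
  {f : C(G, ℂ) // ∃ g : ℂ → ℂ, AnalyticOnNhd ℂ g G ∧ ∀ z : G, f z = g z}

/-- The half-plane `ℍ_h = {ω : Im ω > -h}`. -/
def halfPlane (h : ℝ) : Set ℂ := {ω | -h < ω.im}

/-- The reflection `ω ↦ -ω̄` of `ℍ_h` in the imaginary axis. -/
def reflect {h : ℝ} (ω : halfPlane h) : halfPlane h :=
  ⟨-conj (ω : ℂ), by
    have hω : -h < (ω : ℂ).im := ω.2
    simpa [halfPlane] using hω⟩

/-- For `h > 0` the real line lies in `ℍ_h`. -/
def realPoint {h : ℝ} (hh : 0 < h) (x : ℝ) : halfPlane h :=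
  ⟨(x : ℂ), by simpa [halfPlane] using hh⟩

/-- The class `K_h` of admissible functions: symmetry, passivity, plasma limit.
In the last condition `ω → ∞` inside `ℍ_h`. -/
def admissible (h : ℝ) : Set (HolSpace (halfPlane h)) :=
  {f | (∀ ω : halfPlane h, conj (f.1 ω) = f.1 (reflect ω)) ∧
    (∀ ω : halfPlane h, 0 < (ω : ℂ).re → 0 < (f.1 ω).im) ∧
    ∃ A : ℝ, 0 < A ∧
      (fun ω : halfPlane h => f.1 ω - (-(A : ℂ) * ((ω : ℂ) ^ 2)⁻¹))
        =O[comap (Subtype.val : halfPlane h → ℂ) (Bornology.cobounded ℂ)]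
      (fun ω : halfPlane h => ((ω : ℂ) ^ 3)⁻¹)}

/-- The cut plane `ℂ \ [0, ∞)`. -/
def cutPlane : Set ℂ := {z | z.re < 0 ∨ z.im ≠ 0}

/-- Stieltjes functions: either nonnegative constants, or functions with positive imaginary part
in the upper half-plane, analytic there and on the negative real axis, where they take real
nonnegative values (such a function is automatically non-constant). A function of the second kind
continues analytically to `ℂ \ [0, ∞)`, in exactly one way, by Schwarz reflection
`F(z̄) = conj (F z)`, and is regarded as a function on this cut plane. Values of `F` on `[0, ∞)`
are irrelevant. -/
def IsStieltjes (F : ℂ → ℂ) : Prop :=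
  (∃ c : ℝ, 0 ≤ c ∧ ∀ z ∈ cutPlane, F z = c) ∨
  (AnalyticOnNhd ℂ F cutPlane ∧
    (∀ z : ℂ, 0 < z.im → 0 < (F z).im) ∧
    ∀ x : ℝ, x < 0 → (F x).im = 0 ∧ 0 ≤ (F x).re)

/-- The set `S_h` of functions `f(ω) = F((ω + ih)²)` with `F` a Stieltjes function. -/
def stieltjesClass (h : ℝ) : Set (HolSpace (halfPlane h)) :=
  {f | ∃ F : ℂ → ℂ, IsStieltjes F ∧
    ∀ ω : halfPlane h, f.1 ω = F (((ω : ℂ) + Complex.I * h) ^ 2)}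

/-- The (extended) `L²(0,1)` norm of the restriction of `f ∈ H(ℍ_h)` to the interval `(0,1)`. -/
noncomputable def normL2 {h : ℝ} (hh : 0 < h) (f : HolSpace (halfPlane h)) : ENNReal :=
  eLpNorm (fun x : ℝ => f.1 (realPoint hh x)) 2 (volume.restrict (Set.Ioo 0 1))

/-- A family in `H(G)` is normal if every sequence in it has a subsequence that converges
in `H(G)`; the limit need not belong to the family. -/
def IsNormalFamily {G : Set ℂ} (𝓕 : Set (HolSpace G)) : Prop :=
  ∀ u : ℕ → HolSpace G, (∀ n, u n ∈ 𝓕) →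
    ∃ f : HolSpace G, ∃ φ : ℕ → ℕ, StrictMono φ ∧ Tendsto (u ∘ φ) atTop (𝓝 f)

end Permittivity

namespace Permittivity

/-! The substitution `z = (ω + ih)²` carries `ℍ_h` onto the cut plane, so Stieltjes functions become
functions on `ℍ_h` described by pointwise conditions (`passiveCone`): symmetry, `Im f ≥ 0` on the
right, `f ≥ 0` on the imaginary axis. These conditions are closed. An admissible `f` meets them
because it is real and decreasing up the imaginary axis, with limit `0` by the plasma condition.
Hence the closure lies in `S_h`.

Conversely, replace `F` by `1 / (1 / G - s z)` with `G z = F (z / (1 - s z)) + s`. The Möbius map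
sends `∞` to `-1/s`, where `F` is analytic, so `G` has a positive limit at `∞` and the term `-s z`
forces the asymptotics `-1 / (s z)`. Letting `s → 0` recovers `F` locally uniformly.

For normality, `f + 1` omits the closed negative axis, so its square root has positive real part and
obeys Harnack's inequality on discs. Through the centre of a disc containing `(0,1)` and a given
point, the `L²` bound on `(0,1)` becomes a local bound (`exists_local_bound`), and Montel's theorem
applies. -/

theorem isOpen_halfPlane (h : ℝ) : IsOpen (halfPlane h) :=
  isOpen_lt continuous_const Complex.continuous_im

/-! ### The cut plane and Stieltjes functions -/

theorem mem_cutPlane_iff_neg_mem_slitPlane {z : ℂ} : z ∈ cutPlane ↔ -z ∈ Complex.slitPlane := by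
  simp [cutPlane, Complex.mem_slitPlane_iff]

theorem cutPlane_eq_preimage : cutPlane = Neg.neg ⁻¹' Complex.slitPlane :=
  Set.ext fun _ => mem_cutPlane_iff_neg_mem_slitPlane

theorem isOpen_cutPlane : IsOpen cutPlane := by
  rw [cutPlane_eq_preimage]
  exact Complex.isOpen_slitPlane.preimage continuous_neg

theorem isPreconnected_cutPlane : IsPreconnected cutPlane := by
  have : cutPlane = Neg.neg '' Complex.slitPlane := by
    rw [cutPlane_eq_preimage]
    exact (Set.image_neg_eq_neg (s := Complex.slitPlane)).symm
  rw [this]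
  exact (Complex.starConvex_one_slitPlane.isPathConnected
    Complex.one_mem_slitPlane).isConnected.isPreconnected.image _ continuous_neg.continuousOn

theorem conj_mem_cutPlane {z : ℂ} (hz : z ∈ cutPlane) : conj z ∈ cutPlane := by
  simpa [cutPlane] using hz

theorem neg_real_mem_cutPlane {x : ℝ} (hx : x < 0) : (x : ℂ) ∈ cutPlane := by
  simp [cutPlane, hx]

/-- The square of a point of the open upper half-plane lies in the cut plane. -/
theorem sq_mem_cutPlane {ζ : ℂ} (hζ : 0 < ζ.im) : ζ ^ 2 ∈ cutPlane := by
  by_cases h : ζ.re = 0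
  · left
    simp [pow_two, h]
    positivity
  · right
    simp only [pow_two, Complex.mul_im]
    have := mul_ne_zero h hζ.ne'
    intro h'
    apply this
    linarith

theorem reflect_of_re_eq_zero {h : ℝ} {ω : halfPlane h} (hω : (ω : ℂ).re = 0) :
    reflect ω = ω :=
  Subtype.ext (Complex.ext (by simp [reflect, hω]) (by simp [reflect]))

theorem shift_im_pos {h : ℝ} (ω : halfPlane h) : 0 < ((ω : ℂ) + Complex.I * h).im := by
  have hω : -h < (ω : ℂ).im := ω.2
  simp
  linarith

theorem shift_sq_mem_cutPlane {h : ℝ} (ω : halfPlane h) :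
    ((ω : ℂ) + Complex.I * h) ^ 2 ∈ cutPlane := sq_mem_cutPlane (shift_im_pos ω)

theorem shift_reflect_sq {h : ℝ} (ω : halfPlane h) :
    ((reflect ω : ℂ) + Complex.I * h) ^ 2 = conj (((ω : ℂ) + Complex.I * h) ^ 2) := by
  simp [reflect]
  ring

theorem shift_sq_im {h : ℝ} (ω : halfPlane h) :
    (((ω : ℂ) + Complex.I * h) ^ 2).im = 2 * (ω : ℂ).re * ((ω : ℂ) + Complex.I * h).im := by
  simp [pow_two]
  ring

/-- A function analytic on the cut plane and real on the negative axis is symmetric. -/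
theorem conj_symm_of_real_on_neg {F : ℂ → ℂ} (hF : AnalyticOnNhd ℂ F cutPlane)
    (hr : ∀ x : ℝ, x < 0 → (F x).im = 0) {z : ℂ} (hz : z ∈ cutPlane) :
    F (conj z) = conj (F z) := by
  have hd : AnalyticOnNhd ℂ (fun z => conj (F (conj z))) cutPlane := by
    refine DifferentiableOn.analyticOnNhd (fun w hw => ?_) isOpen_cutPlane
    have h1 := (hF _ (conj_mem_cutPlane hw)).differentiableAt
    have := h1.conj_conj
    simp only [Complex.conj_conj] at this
    exact this.differentiableWithinAt
  have key := hd.eqOn_of_preconnected_of_frequently_eq hF isPreconnected_cutPlane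
    (z₀ := ((-1 : ℝ) : ℂ)) (neg_real_mem_cutPlane (by norm_num)) ?_
  · have := key hz
    simp only at this
    rw [← this, Complex.conj_conj]
  -- The identity theorem needs agreement only along points accumulating at `-1`; these are taken on
  -- the negative axis.
  · have hφ : Tendsto (fun t : ℝ => ((-1 - t : ℝ) : ℂ)) (𝓝[>] 0) (𝓝[≠] ((-1 : ℝ) : ℂ)) := by
      refine tendsto_nhdsWithin_iff.2 ⟨?_, ?_⟩
      · have : ContinuousAt (fun t : ℝ => ((-1 - t : ℝ) : ℂ)) 0 := by fun_prop
        have h2 := this.tendsto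
        simp only [sub_zero] at h2
        exact h2.mono_left nhdsWithin_le_nhds
      · filter_upwards [self_mem_nhdsWithin] with t ht
        have ht' : 0 < t := ht
        simp only [Set.mem_compl_iff, Set.mem_singleton_iff, Complex.ofReal_inj]
        linarith
    refine hφ.frequently (Eventually.frequently ?_)
    filter_upwards [self_mem_nhdsWithin] with t ht
    have ht' : 0 < t := ht
    rw [Complex.conj_ofReal]
    exact Complex.conj_eq_iff_im.2 (hr _ (by linarith))

namespace IsStieltjes

variable {F : ℂ → ℂ}

theorem analyticOnNhd (hF : IsStieltjes F) : AnalyticOnNhd ℂ F cutPlane := by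
  rcases hF with ⟨c, -, hc⟩ | ⟨h, -⟩
  · refine DifferentiableOn.analyticOnNhd ?_ isOpen_cutPlane
    exact (differentiableOn_const (c : ℂ)).congr hc
  · exact h

theorem im_eq_zero (hF : IsStieltjes F) {x : ℝ} (hx : x < 0) : (F x).im = 0 := by
  rcases hF with ⟨c, -, hc⟩ | ⟨-, -, h⟩
  · simp [hc _ (neg_real_mem_cutPlane hx)]
  · exact (h x hx).1

theorem re_nonneg (hF : IsStieltjes F) {x : ℝ} (hx : x < 0) : 0 ≤ (F x).re := by
  rcases hF with ⟨c, h0, hc⟩ | ⟨-, -, h⟩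
  · simpa [hc _ (neg_real_mem_cutPlane hx)] using h0
  · exact (h x hx).2

theorem im_nonneg (hF : IsStieltjes F) {z : ℂ} (hz : 0 < z.im) : 0 ≤ (F z).im := by
  rcases hF with ⟨c, h0, hc⟩ | ⟨-, h, -⟩
  · simp [hc z (Or.inr hz.ne')]
  · exact (h z hz).le

theorem apply_conj (hF : IsStieltjes F) {z : ℂ} (hz : z ∈ cutPlane) :
    F (conj z) = conj (F z) :=
  conj_symm_of_real_on_neg hF.analyticOnNhd (fun _ hx => hF.im_eq_zero hx) hz

/-- Adding a positive constant moves the values off the closed negative axis. -/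
theorem add_mem_slitPlane (hF : IsStieltjes F) {s : ℝ} (hs : 0 < s) {z : ℂ} (hz : z ∈ cutPlane) :
    F z + s ∈ Complex.slitPlane := by
  rcases hF with ⟨c, h0, hc⟩ | hF2
  · rw [hc z hz, ← Complex.ofReal_add]
    exact Complex.ofReal_mem_slitPlane.2 (by linarith)
  · have hF : IsStieltjes F := Or.inr hF2
    rw [Complex.mem_slitPlane_iff]
    rcases lt_trichotomy z.im 0 with h | h | h
    · right
      have h1 := hF2.2.1 (conj z) (by simpa using h)
      rw [hF.apply_conj hz, Complex.conj_im] at h1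
      simp
      linarith
    · left
      have hx : z.re < 0 := hz.resolve_right (by simp [h])
      have hz' : z = (z.re : ℂ) := Complex.ext rfl (by simp [h])
      have := hF.re_nonneg hx
      rw [← hz'] at this
      simp
      linarith
    · right
      have h1 := hF2.2.1 z h
      simp
      linarith

end IsStieltjes

/-! ### The Stieltjes class as a closed cone -/

/-- Symmetric functions with nonnegative imaginary part in the right half of `ℍ_h` and nonnegative
values on the imaginary axis. -/
def passiveCone (h : ℝ) : Set (HolSpace (halfPlane h)) :=
  {f | (∀ ω : halfPlane h, conj (f.1 ω) = f.1 (reflect ω)) ∧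
    (∀ ω : halfPlane h, 0 < (ω : ℂ).re → 0 ≤ (f.1 ω).im) ∧
    ∀ ω : halfPlane h, (ω : ℂ).re = 0 → 0 ≤ (f.1 ω).re}

theorem stieltjesClass_subset_passiveCone (h : ℝ) : stieltjesClass h ⊆ passiveCone h := by
  rintro f ⟨F, hF, hf⟩
  refine ⟨fun ω => ?_, fun ω hω => ?_, fun ω hω => ?_⟩
  · rw [hf, hf, shift_reflect_sq, hF.apply_conj (shift_sq_mem_cutPlane ω)]
  · rw [hf]
    refine hF.im_nonneg ?_
    rw [shift_sq_im]
    have := shift_im_pos ω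
    positivity
  · rw [hf]
    have him : (((ω : ℂ) + Complex.I * h) ^ 2).im = 0 := by rw [shift_sq_im, hω]; ring
    have hre := (shift_sq_mem_cutPlane ω).resolve_right (by simp [him])
    have hz : ((ω : ℂ) + Complex.I * h) ^ 2 = ((((ω : ℂ) + Complex.I * h) ^ 2).re : ℂ) :=
      Complex.ext rfl (by rw [him]; simp)
    rw [hz]
    exact hF.re_nonneg hre

/-- The square root of `z` in the upper half-plane, for `z` in the cut plane. -/
noncomputable def upperSqrt (z : ℂ) : ℂ := Complex.I * (-z) ^ (1 / 2 : ℂ)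

theorem upperSqrt_sq (z : ℂ) : upperSqrt z ^ 2 = z := by
  have h2 : ((-z) ^ (1 / 2 : ℂ)) ^ 2 = -z := by
    simp
  rw [upperSqrt, mul_pow, h2]
  simp

theorem cpow_half_re_pos {w : ℂ} (hw : w ∈ Complex.slitPlane) : 0 < (w ^ (1 / 2 : ℂ)).re := by
  have h0 : w ≠ 0 := Complex.slitPlane_ne_zero hw
  have harg := (Complex.mem_slitPlane_iff_arg.1 hw).1
  have h1 := Complex.neg_pi_lt_arg w
  have h2 := lt_of_le_of_ne (Complex.arg_le_pi w) harg
  rw [Complex.cpow_def_of_ne_zero h0, Complex.exp_re]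
  refine mul_pos (Real.exp_pos _) (Real.cos_pos_of_mem_Ioo ⟨?_, ?_⟩)
  · simp [Complex.mul_im, Complex.log_im]
    linarith
  · simp [Complex.mul_im, Complex.log_im]
    linarith

theorem upperSqrt_im_pos {z : ℂ} (hz : z ∈ cutPlane) : 0 < (upperSqrt z).im := by
  have := cpow_half_re_pos (mem_cutPlane_iff_neg_mem_slitPlane.1 hz)
  simpa [upperSqrt] using this

theorem upperSqrt_of_sq {ζ : ℂ} (hζ : 0 < ζ.im) : upperSqrt (ζ ^ 2) = ζ := by
  have h1 := upperSqrt_sq (ζ ^ 2)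
  have h2 := upperSqrt_im_pos (sq_mem_cutPlane hζ)
  rcases sq_eq_sq_iff_eq_or_eq_neg.1 h1 with h | h
  · exact h
  · rw [h] at h2
    simp at h2
    linarith

theorem differentiableOn_upperSqrt : DifferentiableOn ℂ upperSqrt cutPlane := by
  intro z hz
  have := mem_cutPlane_iff_neg_mem_slitPlane.1 hz
  refine DifferentiableAt.differentiableWithinAt ?_
  unfold upperSqrt
  exact (differentiableAt_id.neg.cpow_const this).const_mul _

/-- Open mapping: if `Im F` vanishes somewhere in the upper half-plane, an open image would contain
points below the real axis. So `F` is constant, and its value at `-1` is real and nonnegative. -/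
theorem isStieltjes_of_im_nonneg {F : ℂ → ℂ} (hF : AnalyticOnNhd ℂ F cutPlane)
    (him : ∀ z : ℂ, 0 < z.im → 0 ≤ (F z).im)
    (hneg : ∀ x : ℝ, x < 0 → (F x).im = 0 ∧ 0 ≤ (F x).re) : IsStieltjes F := by
  by_cases hpos : ∀ z : ℂ, 0 < z.im → 0 < (F z).im
  · exact Or.inr ⟨hF, hpos, hneg⟩
  left
  push Not at hpos
  obtain ⟨z₀, hz₀, hFz₀⟩ := hpos
  have hU : IsOpen {z : ℂ | 0 < z.im} := isOpen_lt continuous_const Complex.continuous_im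
  have hUc : IsPreconnected {z : ℂ | 0 < z.im} :=
    (convex_halfSpace_im_gt 0).isPreconnected
  have hFU : AnalyticOnNhd ℂ F {z : ℂ | 0 < z.im} := hF.mono fun z hz => Or.inr (ne_of_gt hz)
  rcases hFU.is_constant_or_isOpen hUc with ⟨w, hw⟩ | hopen
  · have heq : Set.EqOn F (fun _ => w) cutPlane := by
      refine hF.eqOn_of_preconnected_of_eventuallyEq analyticOnNhd_const
        isPreconnected_cutPlane (z₀ := z₀) (Or.inr hz₀.ne') ?_
      filter_upwards [hU.mem_nhds hz₀] with z hz using hw z hz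
    have h1 := hneg (-1) (by norm_num)
    have h2 := heq (neg_real_mem_cutPlane (x := -1) (by norm_num))
    rw [h2] at h1
    refine ⟨w.re, h1.2, fun z hz => ?_⟩
    rw [heq hz]
    exact Complex.ext rfl (by simp [h1.1])
  · exfalso
    have ho := hopen _ subset_rfl hU
    have hmem : F z₀ ∈ F '' {z : ℂ | 0 < z.im} := ⟨z₀, hz₀, rfl⟩
    obtain ⟨ε, hε, hb⟩ := Metric.isOpen_iff.1 ho _ hmem
    have : F z₀ - Complex.I * ((ε / 2 : ℝ) : ℂ) ∈ Metric.ball (F z₀) ε := by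
      rw [Metric.mem_ball, dist_eq_norm]
      simp [abs_of_pos hε, hε]
    obtain ⟨z, hz, hzF⟩ := hb this
    have h1 := him z hz
    rw [hzF] at h1
    simp at h1
    linarith

/-- The inverse substitution `ω = √z - ih` takes the upper half-plane to the right half of `ℍ_h` and
the negative axis to the imaginary axis, where symmetry makes `f` real. -/
theorem passiveCone_subset_stieltjesClass (h : ℝ) : passiveCone h ⊆ stieltjesClass h := by
  rintro f ⟨hsymm, him, hre⟩
  obtain ⟨g, hg, hfg⟩ := f.2
  have hmem : ∀ z ∈ cutPlane, upperSqrt z - Complex.I * h ∈ halfPlane h := fun z hz => by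
    have := upperSqrt_im_pos hz
    simp [halfPlane]
    linarith
  have hmul : ∀ z : ℂ, 2 * (upperSqrt z).re * (upperSqrt z).im = z.im := fun z => by
    conv_rhs => rw [← upperSqrt_sq z]
    simp [pow_two]
    ring
  refine ⟨fun z => g (upperSqrt z - Complex.I * h), ?_, fun ω => ?_⟩
  · refine isStieltjes_of_im_nonneg ?_ (fun z hz => ?_) (fun x hx => ?_)
    · refine DifferentiableOn.analyticOnNhd ?_ isOpen_cutPlane
      exact hg.differentiableOn.comp (differentiableOn_upperSqrt.sub_const _) hmem
    · have hz' : z ∈ cutPlane := Or.inr hz.ne'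
      have := him ⟨_, hmem z hz'⟩ ?_
      · rwa [hfg] at this
      · have h1 := upperSqrt_im_pos hz'
        have h2 := hmul z
        simp only [Complex.sub_re, Complex.mul_re, Complex.I_re, Complex.ofReal_im, Complex.I_im]
        by_contra hcon
        have : (upperSqrt z).re ≤ 0 := by simpa using hcon
        nlinarith
    · have hx' := neg_real_mem_cutPlane hx
      have hr0 : (upperSqrt x).re = 0 := by
        have h1 := upperSqrt_im_pos hx'
        have h2 := hmul x
        simp only [Complex.ofReal_im, mul_eq_zero] at h2
        rcases h2 with (h2 | h2) | h2
        · norm_num at h2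
        · exact h2
        · exact absurd h2 h1.ne'
      have hω : (((⟨_, hmem x hx'⟩ : halfPlane h) : ℂ)).re = 0 := by simp [hr0]
      have h1 := hre ⟨_, hmem x hx'⟩ hω
      have h2 := hsymm ⟨_, hmem x hx'⟩
      rw [reflect_of_re_eq_zero hω, Complex.conj_eq_iff_im, hfg] at h2
      rw [hfg] at h1
      exact ⟨h2, h1⟩
  · simp only [upperSqrt_of_sq (shift_im_pos ω), add_sub_cancel_right]
    exact hfg ω

theorem stieltjesClass_eq_passiveCone (h : ℝ) : stieltjesClass h = passiveCone h :=
  (stieltjesClass_subset_passiveCone h).antisymm (passiveCone_subset_stieltjesClass h)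

theorem continuous_eval (h : ℝ) (ω : halfPlane h) :
    Continuous fun f : HolSpace (halfPlane h) => f.1 ω :=
  (continuous_eval_const ω).comp continuous_subtype_val

/-- Evaluations are continuous and the inequalities are weak; strict passivity would not survive
limits. -/
theorem isClosed_passiveCone (h : ℝ) : IsClosed (passiveCone h) := by
  simp only [passiveCone, Set.ofPred_and, Set.ofPred_forall]
  refine IsClosed.inter ?_ (IsClosed.inter ?_ ?_)
  · exact isClosed_iInter fun ω => isClosed_eq
      (Complex.continuous_conj.comp (continuous_eval h ω)) (continuous_eval h _)
  · exact isClosed_iInter fun ω => isClosed_iInter fun _ => isClosed_le continuous_const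
      (Complex.continuous_im.comp (continuous_eval h ω))
  · exact isClosed_iInter fun ω => isClosed_iInter fun _ => isClosed_le continuous_const
      (Complex.continuous_re.comp (continuous_eval h ω))

/-! ### Admissible functions lie in the cone -/

/-- If `Im g ≥ 0` to the right of `z` and `Im (g z) = 0`, then `Im (g' z) ≥ 0`. -/
theorem im_deriv_nonneg_of_im_nonneg_right {g : ℂ → ℂ} {z g' : ℂ} (hg : HasDerivAt g g' z)
    (h0 : (g z).im = 0) (hpos : ∀ᶠ ε : ℝ in 𝓝[>] 0, 0 ≤ (g (z + ε)).im) : 0 ≤ g'.im := by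
  have h1 : HasDerivAt (fun ε : ℝ => g (z + ε)) g' 0 := by
    have h2 : HasDerivAt (fun ε : ℝ => z + (ε : ℂ)) 1 0 :=
      (Complex.ofRealCLM.hasDerivAt (x := (0 : ℝ))).const_add z
    have h3 : HasDerivAt g g' (z + ((0 : ℝ) : ℂ)) := by simpa using hg
    have h5 := h3.comp (0 : ℝ) h2
    rwa [mul_one] at h5
  have h4 : HasDerivAt (fun ε : ℝ => (g (z + ε)).im) g'.im 0 :=
    Complex.imCLM.hasFDerivAt.comp_hasDerivAt (0 : ℝ) h1
  have h5 := h4.tendsto_slope_zero_right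
  refine ge_of_tendsto h5 ?_
  filter_upwards [hpos, self_mem_nhdsWithin] with ε hε hε0
  have hε0' : 0 < ε := hε0
  simp only [zero_add, Complex.ofReal_zero, add_zero, h0, sub_zero, smul_eq_mul]
  positivity

/-- By the chain rule `d/dy Re g(iy) = -Im g'(iy)`. Since `g` is real on the axis and `Im g ≥ 0` to
its right, `Im g' ≥ 0` there. -/
theorem re_imagAxis_antitone {h : ℝ} {f : HolSpace (halfPlane h)} {g : ℂ → ℂ}
    (hg : AnalyticOnNhd ℂ g (halfPlane h)) (hfg : ∀ z : halfPlane h, f.1 z = g z)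
    (hsymm : ∀ ω : halfPlane h, conj (f.1 ω) = f.1 (reflect ω))
    (him : ∀ ω : halfPlane h, 0 < (ω : ℂ).re → 0 ≤ (f.1 ω).im) :
    AntitoneOn (fun y : ℝ => (g (Complex.I * y)).re) (Set.Ioi (-h)) := by
  have hmem : ∀ y ∈ Set.Ioi (-h), Complex.I * (y : ℂ) ∈ halfPlane h := fun y hy => by
    simpa [halfPlane] using hy
  have hder : ∀ y ∈ Set.Ioi (-h), HasDerivAt (fun y : ℝ => (g (Complex.I * y)).re)
      (-(deriv g (Complex.I * y)).im) y := fun y hy => by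
    have h1 := (hg _ (hmem y hy)).differentiableAt.hasDerivAt
    have h2 : HasDerivAt (fun y : ℝ => Complex.I * (y : ℂ)) (Complex.I * 1) y :=
      (Complex.ofRealCLM.hasDerivAt (x := y)).const_mul Complex.I
    have h3 := Complex.reCLM.hasFDerivAt.comp_hasDerivAt y (h1.comp y h2)
    rw [mul_one] at h3
    have h4 : (Complex.reCLM : ℂ → ℝ) (deriv g (Complex.I * y) * Complex.I) =
        -(deriv g (Complex.I * y)).im := by simp
    rw [← h4]
    exact h3
  refine antitoneOn_of_deriv_nonpos (convex_Ioi _)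
    (fun y hy => (hder y hy).continuousAt.continuousWithinAt) ?_ ?_
  · rw [interior_Ioi]
    exact fun y hy => (hder y hy).differentiableAt.differentiableWithinAt
  · rw [interior_Ioi]
    intro y hy
    rw [(hder y hy).deriv, neg_nonpos]
    refine im_deriv_nonneg_of_im_nonneg_right
      (hg _ (hmem y hy)).differentiableAt.hasDerivAt ?_ ?_
    · have := hsymm ⟨_, hmem y hy⟩
      rw [reflect_of_re_eq_zero (by simp), hfg, Complex.conj_eq_iff_im] at this
      exact this
    · filter_upwards [self_mem_nhdsWithin] with ε hε
      have hm : Complex.I * (y : ℂ) + (ε : ℂ) ∈ halfPlane h := by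
        simpa [halfPlane] using hy
      have := him ⟨_, hm⟩ (by simpa using hε)
      rwa [hfg] at this

theorem tendsto_zero_of_plasmaLimit {h : ℝ} {f : HolSpace (halfPlane h)} {A : ℝ}
    (hL : (fun ω : halfPlane h => f.1 ω - (-(A : ℂ) * ((ω : ℂ) ^ 2)⁻¹))
        =O[comap (Subtype.val : halfPlane h → ℂ) (Bornology.cobounded ℂ)]
      (fun ω : halfPlane h => ((ω : ℂ) ^ 3)⁻¹)) :
    Tendsto f.1 (comap (Subtype.val : halfPlane h → ℂ) (Bornology.cobounded ℂ)) (𝓝 0) := by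
  have hval : Tendsto (Subtype.val : halfPlane h → ℂ)
      (comap (Subtype.val : halfPlane h → ℂ) (Bornology.cobounded ℂ))
      (Bornology.cobounded ℂ) := tendsto_comap
  have hinv := tendsto_inv₀_cobounded.comp hval
  have h3 : Tendsto (fun ω : halfPlane h => ((ω : ℂ) ^ 3)⁻¹)
      (comap (Subtype.val : halfPlane h → ℂ) (Bornology.cobounded ℂ)) (𝓝 0) := by
    simpa [Function.comp_def, inv_pow] using hinv.pow 3
  have h2 : Tendsto (fun ω : halfPlane h => -(A : ℂ) * ((ω : ℂ) ^ 2)⁻¹)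
      (comap (Subtype.val : halfPlane h → ℂ) (Bornology.cobounded ℂ)) (𝓝 0) := by
    simpa [Function.comp_def, inv_pow] using (hinv.pow 2).const_mul (-(A : ℂ))
  simpa using (hL.trans_tendsto h3).add h2

theorem admissible_subset_passiveCone {h : ℝ} : admissible h ⊆ passiveCone h := by
  rintro f ⟨hsymm, him, A, -, hL⟩
  refine ⟨hsymm, fun ω hω => (him ω hω).le, fun ω hω => ?_⟩
  obtain ⟨g, hg, hfg⟩ := f.2
  have hanti := re_imagAxis_antitone hg hfg hsymm fun ω hω => (him ω hω).le
  have hmem : ∀ y : ℝ, -h < y → Complex.I * (y : ℂ) ∈ halfPlane h := fun y hy => by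
    simpa [halfPlane] using hy
  -- The maximum keeps the point in `ℍ_h` and no lower than `ω` for every `y`, so monotonicity
  -- applies throughout.
  let ι : ℝ → halfPlane h := fun y =>
    ⟨Complex.I * ((max y ω.1.im : ℝ) : ℂ), hmem _ (lt_max_of_lt_right ω.2)⟩
  have hι : Tendsto ι atTop
      (comap (Subtype.val : halfPlane h → ℂ) (Bornology.cobounded ℂ)) := by
    rw [tendsto_comap_iff, ← tendsto_norm_atTop_iff_cobounded]
    refine tendsto_atTop_mono (f := id) (fun y => ?_) tendsto_id
    simp only [ι, Function.comp, norm_mul, Complex.norm_I, one_mul, Complex.norm_real, id]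
    exact (le_max_left _ _).trans (le_abs_self _)
  have hlim : Tendsto (fun y => (f.1 (ι y)).re) atTop (𝓝 0) := by
    have := (Complex.continuous_re.tendsto 0).comp ((tendsto_zero_of_plasmaLimit hL).comp hι)
    simpa [Function.comp_def] using this
  refine le_of_tendsto hlim (Eventually.of_forall fun y => ?_)
  have h1 := hanti (a := ω.1.im) (b := max y ω.1.im) ω.2
    (Set.mem_Ioi.2 (lt_max_of_lt_right ω.2)) (le_max_right _ _)
  have hω' : (ω : ℂ) = Complex.I * (ω.1.im : ℂ) := Complex.ext (by simp [hω]) (by simp)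
  simp only at h1
  rw [← hω', ← hfg ω] at h1
  rw [hfg (ι y)]
  exact h1

theorem closure_admissible_subset (h : ℝ) : closure (admissible h) ⊆ stieltjesClass h := by
  rw [stieltjesClass_eq_passiveCone]
  exact closure_minimal admissible_subset_passiveCone (isClosed_passiveCone h)

/-! ### Regularization of a Stieltjes function -/

/-- The function `F (z / (1 - s z)) + s`. -/
noncomputable def shiftedMobius (F : ℂ → ℂ) (s : ℝ) (z : ℂ) : ℂ := F (z / (1 - s * z)) + s

/-- The regularization `1 / (1 / G - s z)` of `F`, where `G z = F (z / (1 - s z)) + s`. -/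
noncomputable def regularize (F : ℂ → ℂ) (s : ℝ) (z : ℂ) : ℂ :=
  shiftedMobius F s z / (1 - s * z * shiftedMobius F s z)

theorem one_sub_mul_ne_zero {s : ℝ} (hs : 0 ≤ s) {z : ℂ} (hz : z ∈ cutPlane) :
    1 - s * z ≠ 0 := by
  intro h
  have hre := congrArg Complex.re h
  have him := congrArg Complex.im h
  simp at hre him
  rcases hz with hz | hz
  · nlinarith
  · rcases him with rfl | him
    · simp at hre
    · exact hz him

theorem mobius_im {s : ℝ} (z : ℂ) :
    (z / (1 - s * z)).im = z.im / Complex.normSq (1 - s * z) := by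
  rw [Complex.div_im, ← sub_div]
  congr 1
  simp
  ring

theorem mobius_mem_cutPlane {s : ℝ} (hs : 0 ≤ s) {z : ℂ} (hz : z ∈ cutPlane) :
    z / (1 - s * z) ∈ cutPlane := by
  have hn := Complex.normSq_pos.2 (one_sub_mul_ne_zero hs hz)
  by_cases him : z.im = 0
  · left
    have hre := hz.resolve_right (by simp [him])
    rw [Complex.div_re, ← add_div]
    refine div_neg_of_neg_of_pos ?_ hn
    simp [him]
    nlinarith [mul_nonneg hs (sq_nonneg z.re)]
  · right
    rw [mobius_im]
    exact div_ne_zero him hn.ne'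

section

variable {F : ℂ → ℂ} (hF : IsStieltjes F) {s : ℝ} {z : ℂ}
include hF

theorem shiftedMobius_mem_slitPlane (hs : 0 < s) (hz : z ∈ cutPlane) :
    shiftedMobius F s z ∈ Complex.slitPlane :=
  hF.add_mem_slitPlane hs (mobius_mem_cutPlane hs.le hz)

theorem shiftedMobius_conj (hs : 0 ≤ s) (hz : z ∈ cutPlane) :
    shiftedMobius F s (conj z) = conj (shiftedMobius F s z) := by
  have := hF.apply_conj (mobius_mem_cutPlane hs hz)
  simp only [map_div₀, map_sub, map_one, map_mul, Complex.conj_ofReal] at this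
  simp [shiftedMobius, this]

theorem shiftedMobius_im_nonneg (hs : 0 ≤ s) (hz : 0 < z.im) :
    0 ≤ (shiftedMobius F s z).im := by
  have hn := Complex.normSq_pos.2 (one_sub_mul_ne_zero hs (z := z) (Or.inr hz.ne'))
  have : 0 < (z / (1 - s * z)).im := by
    rw [mobius_im]
    positivity
  simpa [shiftedMobius] using hF.im_nonneg this

theorem im_mul_shiftedMobius_im_nonneg (hs : 0 ≤ s) (hz : z ∈ cutPlane) :
    0 ≤ z.im * (shiftedMobius F s z).im := by
  rcases lt_trichotomy z.im 0 with h | h | h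
  · have := shiftedMobius_im_nonneg hF hs (z := conj z) (by simpa using h)
    rw [shiftedMobius_conj hF hs hz, Complex.conj_im] at this
    exact mul_nonneg_of_nonpos_of_nonpos h.le (by linarith)
  · simp [h]
  · exact mul_nonneg h.le (shiftedMobius_im_nonneg hF hs h)

/-- A zero would give `G = 1 / (s z)`. For nonreal `z` this has imaginary part of sign opposite to
`z`; for `z < 0` it is negative. `G` allows neither. -/
theorem regularize_denom_ne_zero (hs : 0 ≤ s) (hz : z ∈ cutPlane) :
    1 - s * z * shiftedMobius F s z ≠ 0 := by
  rcases hs.eq_or_lt with rfl | hs'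
  · simp
  set G := shiftedMobius F s z with hG
  have hG0 := shiftedMobius_mem_slitPlane hF hs' hz
  have him := im_mul_shiftedMobius_im_nonneg hF hs hz
  rw [← hG] at hG0 him
  intro h
  have e1 := congrArg Complex.re h
  have e2 := congrArg Complex.im h
  simp at e1 e2
  have e3 : z.re * G.im + z.im * G.re = 0 :=
    (mul_eq_zero.1 (by linarith : s * (z.re * G.im + z.im * G.re) = 0)).resolve_left hs'.ne'
  have hn : 0 < G.re ^ 2 + G.im ^ 2 := by
    have := Complex.normSq_pos.2 (Complex.slitPlane_ne_zero hG0)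
    rw [Complex.normSq_apply] at this
    linarith
  -- `e4` and `e5` are the two parts of `s z |G|² = conj G`.
  have e4 : s * (z.im * (G.re ^ 2 + G.im ^ 2)) = -G.im := by
    linear_combination G.im * e1 + s * G.re * e3
  have e5 : s * (z.re * (G.re ^ 2 + G.im ^ 2)) = G.re := by
    linear_combination (-G.re) * e1 + s * G.im * e3
  by_cases hzi : z.im = 0
  · have hzr := hz.resolve_right (by simp [hzi])
    rw [hzi] at e4
    have hGi : G.im = 0 := by linarith
    have hGr := (Complex.mem_slitPlane_iff.1 hG0).resolve_right (by simp [hGi])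
    have : s * (z.re * (G.re ^ 2 + G.im ^ 2)) < 0 :=
      mul_neg_of_pos_of_neg hs' (mul_neg_of_neg_of_pos hzr hn)
    linarith
  · have h1 : 0 < z.im ^ 2 := by positivity
    have h2 : 0 < s * (z.im ^ 2 * (G.re ^ 2 + G.im ^ 2)) := by positivity
    have h3 : s * (z.im ^ 2 * (G.re ^ 2 + G.im ^ 2)) = -(z.im * G.im) := by
      linear_combination z.im * e4
    linarith

/-- The numerator of the imaginary part is `Im G + s · Im z · |G|²`; the second term makes it strict
even for constant `F`. -/
theorem regularize_im_pos (hs : 0 < s) (hz : 0 < z.im) : 0 < (regularize F s z).im := by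
  have hzc : z ∈ cutPlane := Or.inr hz.ne'
  have hD := Complex.normSq_pos.2 (regularize_denom_ne_zero hF hs.le hzc)
  have hG := Complex.normSq_pos.2
    (Complex.slitPlane_ne_zero (shiftedMobius_mem_slitPlane hF hs hzc))
  have him := shiftedMobius_im_nonneg hF hs.le hz
  rw [regularize, Complex.div_im, ← sub_div]
  refine div_pos ?_ hD
  set G := shiftedMobius F s z
  rw [Complex.normSq_apply] at hG
  have e : G.im * (1 - s * z * G).re - G.re * (1 - s * z * G).im =
      G.im + s * z.im * (G.re * G.re + G.im * G.im) := by
    simp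
    ring
  rw [e]
  have : 0 < s * z.im * (G.re * G.re + G.im * G.im) := by positivity
  linarith

theorem regularize_conj (hs : 0 ≤ s) (hz : z ∈ cutPlane) :
    regularize F s (conj z) = conj (regularize F s z) := by
  simp [regularize, shiftedMobius_conj hF hs hz]

theorem analyticOnNhd_regularize (hs : 0 ≤ s) : AnalyticOnNhd ℂ (regularize F s) cutPlane := by
  refine DifferentiableOn.analyticOnNhd ?_ isOpen_cutPlane
  have hG : DifferentiableOn ℂ (shiftedMobius F s) cutPlane := by
    refine DifferentiableOn.add_const _ (hF.analyticOnNhd.differentiableOn.comp ?_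
      fun z hz => mobius_mem_cutPlane hs hz)
    exact DifferentiableOn.div (by fun_prop) (by fun_prop) fun z hz => one_sub_mul_ne_zero hs hz
  exact hG.div (((differentiableOn_id.const_mul _).mul hG).const_sub 1)
    fun z hz => regularize_denom_ne_zero hF hs hz

theorem continuousOn_regularize :
    ContinuousOn (fun p : ℝ × ℂ => regularize F p.1 p.2) (Set.Ici 0 ×ˢ cutPlane) := by
  have hG : ContinuousOn (fun p : ℝ × ℂ => shiftedMobius F p.1 p.2) (Set.Ici 0 ×ˢ cutPlane) := by
    refine ContinuousOn.add (hF.analyticOnNhd.continuousOn.comp ?_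
      fun p hp => mobius_mem_cutPlane hp.1 hp.2) (by fun_prop)
    exact ContinuousOn.div (by fun_prop) (by fun_prop)
      fun p hp => one_sub_mul_ne_zero hp.1 hp.2
  refine hG.div ?_ fun p hp => regularize_denom_ne_zero hF hp.1 hp.2
  exact continuousOn_const.sub (ContinuousOn.mul (by fun_prop) hG)

omit hF in
theorem tendsto_mobius_cobounded (hs : 0 < s) :
    Tendsto (fun z : ℂ => z / (1 - s * z)) (Bornology.cobounded ℂ) (𝓝 ((-s⁻¹ : ℝ) : ℂ)) := by
  have h1 : Tendsto (fun z : ℂ => (z⁻¹ - s)⁻¹) (Bornology.cobounded ℂ) (𝓝 ((0 - s : ℂ)⁻¹)) :=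
    (tendsto_inv₀_cobounded.sub_const _).inv₀ (by simpa using hs.ne')
  have h2 : (0 - s : ℂ)⁻¹ = ((-s⁻¹ : ℝ) : ℂ) := by
    push_cast
    rw [zero_sub, inv_neg]
  rw [← h2]
  refine h1.congr' ?_
  filter_upwards [Bornology.eventually_ne_cobounded 0] with z hz
  rw [show (z⁻¹ - s : ℂ) = (1 - s * z) / z by field_simp, inv_div]

/-- The limit is `F(-1/s) + s`; the added `s` keeps it nonzero even if `F(-1/s) = 0`. -/
theorem exists_tendsto_shiftedMobius (hs : 0 < s) :
    ∃ c : ℂ, c ≠ 0 ∧ Tendsto (shiftedMobius F s) (Bornology.cobounded ℂ) (𝓝 c) := by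
  have hm : ((-s⁻¹ : ℝ) : ℂ) ∈ cutPlane :=
    neg_real_mem_cutPlane (neg_lt_zero.2 (inv_pos.2 hs))
  refine ⟨F ((-s⁻¹ : ℝ) : ℂ) + s, Complex.slitPlane_ne_zero (hF.add_mem_slitPlane hs hm), ?_⟩
  exact (((hF.analyticOnNhd _ hm).continuousAt.tendsto).comp
    (tendsto_mobius_cobounded hs)).add_const _

/-- The left side equals `s⁻¹ z⁻² (z⁻¹ - s G)⁻¹`, whose last factor converges because `G` has a
nonzero limit. -/
theorem regularize_add_isBigO (hs : 0 < s) :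
    (fun z => regularize F s z + (s * z)⁻¹) =O[Bornology.cobounded ℂ ⊓ 𝓟 cutPlane]
      fun z => (z ^ 2)⁻¹ := by
  obtain ⟨c, hc, hG⟩ := exists_tendsto_shiftedMobius hF hs
  have hD : Tendsto (fun z => (z⁻¹ - s * shiftedMobius F s z)⁻¹) (Bornology.cobounded ℂ)
      (𝓝 (0 - s * c)⁻¹) :=
    (tendsto_inv₀_cobounded.sub (hG.const_mul _)).inv₀ (by simp [hs.ne', hc])
  have hO := ((hD.isBigO_one ℂ).mono
    (inf_le_left : Bornology.cobounded ℂ ⊓ 𝓟 cutPlane ≤ _)).const_mul_left ((s : ℂ)⁻¹)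
  have hO2 := hO.mul (isBigO_refl (fun z : ℂ => (z ^ 2)⁻¹) _)
  refine (hO2.congr' ?_ (by simp))
  filter_upwards [(Bornology.eventually_ne_cobounded (0 : ℂ)).filter_mono inf_le_left,
    mem_inf_of_right (mem_principal_self cutPlane)] with z hz hzc
  have hd := regularize_denom_ne_zero hF hs.le hzc
  have hs' : (s : ℂ) ≠ 0 := by exact_mod_cast hs.ne'
  rw [regularize]
  set G := shiftedMobius F s z
  rw [show z⁻¹ - s * G = (1 - s * z * G) / z by field_simp, inv_div]
  field_simp
  ring

end

/-! ### Plasma limit of the regularizations and density -/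

theorem shift_isEquivalent (h : ℝ) :
    (fun ω : ℂ => ω + Complex.I * h) ~[Bornology.cobounded ℂ] fun ω => ω := by
  refine IsEquivalent.refl.add_isLittleO ?_
  exact isLittleO_const_left.2 (Or.inr tendsto_norm_cobounded_atTop)

theorem inv_shift_sq_sub_isBigO (h : ℝ) :
    (fun ω : ℂ => ((ω + Complex.I * h) ^ 2)⁻¹ - (ω ^ 2)⁻¹) =O[Bornology.cobounded ℂ]
      fun ω => (ω ^ 3)⁻¹ := by
  have hinv : (fun ω : ℂ => (ω + Complex.I * h)⁻¹) =O[Bornology.cobounded ℂ] fun ω => ω⁻¹ :=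
    (shift_isEquivalent h).inv.isBigO
  have hc : (fun _ : ℂ => -(Complex.I * h)) =O[Bornology.cobounded ℂ] fun _ => (1 : ℂ) :=
    isBigO_const_const _ one_ne_zero _
  have h1 : (fun ω : ℂ => (ω + Complex.I * h)⁻¹ - ω⁻¹) =O[Bornology.cobounded ℂ]
      fun ω => ω⁻¹ * ω⁻¹ := by
    refine ((hc.mul (hinv.mul (isBigO_refl (fun ω : ℂ => ω⁻¹) _)))).congr' ?_ (by simp)
    filter_upwards [Bornology.eventually_ne_cobounded (0 : ℂ),
      Bornology.eventually_ne_cobounded (-(Complex.I * h))] with ω h0 h1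
    have h2 : ω + Complex.I * h ≠ 0 := fun h => h1 (eq_neg_of_add_eq_zero_left h)
    field_simp
    ring
  have h2 := h1.mul (hinv.add (isBigO_refl (fun ω : ℂ => ω⁻¹) _))
  refine h2.congr (fun ω => ?_) (fun ω => ?_)
  · rw [← inv_pow, ← inv_pow]
    ring
  · rw [← inv_pow]
    ring

theorem regularize_shift_isBigO {F : ℂ → ℂ} (hF : IsStieltjes F) {s : ℝ} (hs : 0 < s) (h : ℝ) :
    (fun ω : halfPlane h => regularize F s (((ω : ℂ) + Complex.I * h) ^ 2)
        - (-((s⁻¹ : ℝ) : ℂ) * ((ω : ℂ) ^ 2)⁻¹))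
      =O[comap (Subtype.val : halfPlane h → ℂ) (Bornology.cobounded ℂ)]
    (fun ω : halfPlane h => ((ω : ℂ) ^ 3)⁻¹) := by
  set l := comap (Subtype.val : halfPlane h → ℂ) (Bornology.cobounded ℂ)
  have hval : Tendsto (Subtype.val : halfPlane h → ℂ) l (Bornology.cobounded ℂ) := tendsto_comap
  have hshift : Tendsto (fun ω : ℂ => ω + Complex.I * h) (Bornology.cobounded ℂ)
      (Bornology.cobounded ℂ) := tendsto_add_const_cobounded _
  have hsq : Tendsto (fun ω : ℂ => (ω + Complex.I * h) ^ 2) (Bornology.cobounded ℂ)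
      (Bornology.cobounded ℂ) := (tendsto_pow_cobounded_cobounded two_ne_zero).comp hshift
  have hz : Tendsto (fun ω : halfPlane h => ((ω : ℂ) + Complex.I * h) ^ 2) l
      (Bornology.cobounded ℂ ⊓ 𝓟 cutPlane) :=
    tendsto_inf.2 ⟨hsq.comp hval, tendsto_principal.2 (Eventually.of_forall shift_sq_mem_cutPlane)⟩
  have h1 := (regularize_add_isBigO hF hs).comp_tendsto hz
  have h2 : (fun ω : ℂ => (((ω + Complex.I * h) ^ 2) ^ 2)⁻¹) =O[Bornology.cobounded ℂ]
      fun ω => (ω ^ 3)⁻¹ := by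
    have e := ((shift_isEquivalent h).inv.isBigO).pow 4
    have e1 : (fun ω : ℂ => ω⁻¹) =O[Bornology.cobounded ℂ] fun _ => (1 : ℂ) :=
      tendsto_inv₀_cobounded.isBigO_one ℂ
    have e2 := (isBigO_refl (fun ω : ℂ => (ω ^ 3)⁻¹) (Bornology.cobounded ℂ)).mul e1
    refine (e.congr (fun ω => ?_) (fun ω => ?_)).trans (e2.congr (fun ω => rfl) fun ω => mul_one _)
    · simp only [Pi.inv_apply]
      rw [← pow_mul, inv_pow]
    · simp only [Pi.inv_apply]
      rw [← inv_pow]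
      ring
  have h3 := h1.trans (h2.comp_tendsto hval)
  have h4 := ((inv_shift_sq_sub_isBigO h).comp_tendsto hval).const_mul_left (-(s : ℂ)⁻¹)
  refine (h3.add h4).congr (fun ω => ?_) (fun ω => rfl)
  simp only [Function.comp, mul_inv, Complex.ofReal_inv]
  ring

/-- The regularizations of `F`, as a continuous curve in the space of continuous functions. -/
noncomputable def regularizationCurve {F : ℂ → ℂ} (hF : IsStieltjes F) (h : ℝ) :
    C(Set.Ici (0 : ℝ), C(halfPlane h, ℂ)) :=
  ContinuousMap.curry
    { toFun := fun p => regularize F p.1 (((p.2 : ℂ) + Complex.I * h) ^ 2)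
      continuous_toFun := (continuousOn_regularize hF).comp_continuous
        (f := fun p : Set.Ici (0 : ℝ) × halfPlane h =>
          ((p.1 : ℝ), ((p.2 : ℂ) + Complex.I * h) ^ 2))
        (by fun_prop) fun p => ⟨p.1.2, shift_sq_mem_cutPlane p.2⟩ }

theorem regularizationCurve_apply {F : ℂ → ℂ} (hF : IsStieltjes F) (h : ℝ) (s : Set.Ici (0 : ℝ))
    (ω : halfPlane h) :
    regularizationCurve hF h s ω = regularize F s (((ω : ℂ) + Complex.I * h) ^ 2) := rfl

theorem exists_analytic_regularizationCurve {F : ℂ → ℂ} (hF : IsStieltjes F) (h : ℝ)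
    (s : Set.Ici (0 : ℝ)) :
    ∃ g : ℂ → ℂ, AnalyticOnNhd ℂ g (halfPlane h) ∧
      ∀ z : halfPlane h, regularizationCurve hF h s z = g z := by
  refine ⟨fun ω => regularize F s ((ω + Complex.I * h) ^ 2), ?_, fun _ => rfl⟩
  refine DifferentiableOn.analyticOnNhd ?_ (isOpen_halfPlane h)
  exact (analyticOnNhd_regularize hF s.2).differentiableOn.comp (by fun_prop)
    fun ω hω => shift_sq_mem_cutPlane ⟨ω, hω⟩

theorem regularizationCurve_mem_admissible {F : ℂ → ℂ} (hF : IsStieltjes F) (h : ℝ)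
    (s : Set.Ici (0 : ℝ)) (hs : 0 < (s : ℝ)) :
    (⟨regularizationCurve hF h s, exists_analytic_regularizationCurve hF h s⟩ :
      HolSpace (halfPlane h)) ∈ admissible h := by
  refine ⟨fun ω => ?_, fun ω hω => ?_, (s : ℝ)⁻¹, inv_pos.2 hs, ?_⟩
  · simp only [regularizationCurve_apply]
    rw [shift_reflect_sq, regularize_conj hF hs.le (shift_sq_mem_cutPlane ω)]
  · simp only [regularizationCurve_apply]
    refine regularize_im_pos hF hs ?_
    rw [shift_sq_im]
    have := shift_im_pos ω
    positivity
  · exact regularize_shift_isBigO hF hs h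

/-- Joint continuity of the regularization up to `s = 0` gives, by currying, a continuous curve in
`H(ℍ_h)` that starts at `f` and is admissible for `s > 0`. -/
theorem stieltjesClass_subset_closure_admissible (h : ℝ) :
    stieltjesClass h ⊆ closure (admissible h) := by
  rintro f ⟨F, hF, hf⟩
  let γ : Set.Ici (0 : ℝ) → HolSpace (halfPlane h) := fun s =>
    ⟨regularizationCurve hF h s, exists_analytic_regularizationCurve hF h s⟩
  have hγ : Continuous γ := (regularizationCurve hF h).continuous.subtype_mk _
  have hγ0 : γ ⟨0, Set.self_mem_Ici⟩ = f := by
    refine Subtype.ext (ContinuousMap.ext fun ω => ?_)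
    rw [hf]
    simp [γ, regularizationCurve_apply, regularize, shiftedMobius]
  have hpos : Tendsto (fun ε : ℝ => (⟨max ε 0, Set.mem_Ici.2 (le_max_right _ _)⟩ : Set.Ici (0 : ℝ))) (𝓝[>] 0)
      (𝓝 ⟨0, Set.self_mem_Ici⟩) := by
    have : Continuous fun ε : ℝ => (⟨max ε 0, Set.mem_Ici.2 (le_max_right _ _)⟩ : Set.Ici (0 : ℝ)) := by
      fun_prop
    have h0 := this.tendsto 0
    simp only [max_self] at h0
    exact h0.mono_left nhdsWithin_le_nhds
  rw [← hγ0]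
  refine mem_closure_of_tendsto ((hγ.tendsto _).comp hpos) ?_
  filter_upwards [self_mem_nhdsWithin] with ε hε
  exact regularizationCurve_mem_admissible hF h _ (lt_max_of_lt_left hε)

theorem closure_admissible (h : ℝ) : closure (admissible h) = stieltjesClass h :=
  (closure_admissible_subset h).antisymm (stieltjesClass_subset_closure_admissible h)

/-! ### Harnack inequalities and local bounds -/

theorem norm_sub_le_norm_add {w : ℂ} {b : ℝ} (hw : 0 ≤ w.re) (hb : 0 ≤ b) :
    ‖w - b‖ ≤ ‖w + b‖ := by
  rw [← sq_le_sq₀ (norm_nonneg _) (norm_nonneg _), ← Complex.normSq_eq_norm_sq,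
    ← Complex.normSq_eq_norm_sq, Complex.normSq_apply, Complex.normSq_apply]
  simp
  nlinarith [mul_nonneg hw hb]

theorem cpow_half_sq (w : ℂ) : (w ^ (1 / 2 : ℂ)) ^ 2 = w := by simp

/-- Harnack's inequality for a holomorphic function with positive real part on a ball. -/
theorem harnack_of_re_pos {g : ℂ → ℂ} {c z : ℂ} {R ρ b : ℝ}
    (hg : DifferentiableOn ℂ g (Metric.ball c R)) (hre : ∀ w ∈ Metric.ball c R, 0 < (g w).re)
    (hb : 0 < b) (hgc : g c = b) (hz : z ∈ Metric.ball c R) (hzρ : dist z c ≤ ρ * R) :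
    ‖g z‖ * (1 - ρ) ≤ b * (1 + ρ) ∧ b * (1 - ρ) ≤ ‖g z‖ * (1 + ρ) := by
  have hR : 0 < R := Metric.pos_of_mem_ball hz
  have hne : ∀ w ∈ Metric.ball c R, g w + b ≠ 0 := fun w hw h => by
    have := congrArg Complex.re h
    have := hre w hw
    simp at *
    linarith
  -- The Cayley transform maps the right half-plane into the unit disc and `g c` to `0`, so the
  -- Schwarz lemma applies.
  have hq : DifferentiableOn ℂ (fun w => (g w - b) / (g w + b)) (Metric.ball c R) :=
    (hg.sub_const _).div (hg.add_const _) hne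
  have hmaps : Set.MapsTo (fun w => (g w - b) / (g w + b)) (Metric.ball c R)
      (Metric.closedBall ((g c - b) / (g c + b)) 1) := fun w hw => by
    rw [hgc, sub_self, zero_div, mem_closedBall_zero_iff, norm_div]
    exact div_le_one_of_le₀ (norm_sub_le_norm_add (hre w hw).le hb.le) (norm_nonneg _)
  have key := Complex.dist_le_div_mul_dist_of_mapsTo_ball hq hmaps hz
  simp only [hgc, sub_self, zero_div, dist_zero_right, norm_div] at key
  have key2 : ‖g z - b‖ ≤ ρ * ‖g z + b‖ := by
    rw [div_le_iff₀ (norm_pos_iff.2 (hne z hz))] at key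
    refine key.trans (mul_le_mul_of_nonneg_right ?_ (norm_nonneg _))
    rw [one_div, inv_mul_le_iff₀ hR, mul_comm]
    exact hzρ
  have hρ : 0 ≤ ρ := by
    by_contra hcon
    have := dist_nonneg.trans hzρ
    nlinarith
  have hnb : ‖(b : ℂ)‖ = b := by simp [abs_of_pos hb]
  have h1 : ‖g z + b‖ ≤ ‖g z‖ + b := (norm_add_le _ _).trans_eq (by rw [hnb])
  have h2 : ‖g z - b‖ ≤ ρ * (‖g z‖ + b) := key2.trans (by gcongr)
  have h3 := norm_sub_norm_le (g z) b
  have h4 := norm_sub_norm_le (b : ℂ) (g z)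
  rw [norm_sub_rev] at h4
  rw [hnb] at h3 h4
  constructor <;> linarith

/-- A Harnack inequality for a holomorphic function with values in the slit plane. -/
theorem harnack_of_mapsTo_slitPlane {p : ℂ → ℂ} {c z : ℂ} {R ρ a : ℝ}
    (hp : DifferentiableOn ℂ p (Metric.ball c R))
    (hslit : Set.MapsTo p (Metric.ball c R) Complex.slitPlane)
    (ha : 0 < a) (hpc : p c = a) (hz : z ∈ Metric.ball c R) (hρ : ρ < 1)
    (hzρ : dist z c ≤ ρ * R) :
    ‖p z‖ * (1 - ρ) ^ 2 ≤ a * (1 + ρ) ^ 2 ∧ a * (1 - ρ) ^ 2 ≤ ‖p z‖ * (1 + ρ) ^ 2 := by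
  have hR : 0 < R := Metric.pos_of_mem_ball hz
  have hρ0 : 0 ≤ ρ := by
    by_contra hcon
    have := dist_nonneg.trans hzρ
    nlinarith
  -- The principal square root has positive real part; its Harnack inequality is squared at the end.
  have hd : DifferentiableOn ℂ (fun w => p w ^ (1 / 2 : ℂ)) (Metric.ball c R) :=
    hp.cpow_const hslit
  have hb : 0 < a ^ (1 / 2 : ℝ) := Real.rpow_pos_of_pos ha _
  have hgc : p c ^ (1 / 2 : ℂ) = ((a ^ (1 / 2 : ℝ) : ℝ) : ℂ) := by
    rw [hpc, Complex.ofReal_cpow ha.le]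
    norm_num
  have hb2 : (a ^ (1 / 2 : ℝ)) ^ 2 = a := by
    rw [← Real.sqrt_eq_rpow, Real.sq_sqrt ha.le]
  obtain ⟨h1, h2⟩ := harnack_of_re_pos hd (fun w hw => cpow_half_re_pos (hslit hw)) hb hgc hz hzρ
  have hn : ‖p z ^ (1 / 2 : ℂ)‖ ^ 2 = ‖p z‖ := by rw [← norm_pow, cpow_half_sq]
  have h3 : 0 ≤ 1 - ρ := by linarith
  have h1' := pow_le_pow_left₀ (mul_nonneg (norm_nonneg _) h3) h1 2
  have h2' := pow_le_pow_left₀ (mul_nonneg hb.le h3) h2 2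
  rw [mul_pow, mul_pow, hn, hb2] at h1' h2'
  exact ⟨h1', h2'⟩

/-- Discs with centre `i(R - h)` and radius `R` touch the boundary line at `-ih` and exhaust `ℍ_h`
as `R → ∞`. The middle inequality puts the point `1` in the disc. -/
theorem exists_radius {h : ℝ} (hh : 0 < h) (ω₀ : halfPlane h) :
    ∃ R : ℝ, 0 < R ∧ 1 + (R - h) ^ 2 < R ^ 2 ∧
      dist (ω₀ : ℂ) (Complex.I * ((R - h : ℝ) : ℂ)) < R := by
  have hy : 0 < (ω₀ : ℂ).im + h := by
    have : -h < (ω₀ : ℂ).im := ω₀.2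
    linarith
  set x := (ω₀ : ℂ).re
  set y := (ω₀ : ℂ).im
  have h1 : ∀ᶠ R : ℝ in atTop, 1 + h ^ 2 < 2 * h * R :=
    (tendsto_id.const_mul_atTop (by positivity : 0 < 2 * h)).eventually_gt_atTop _
  have h2 : ∀ᶠ R : ℝ in atTop, x ^ 2 + (y + h) ^ 2 < 2 * (y + h) * R :=
    (tendsto_id.const_mul_atTop (by positivity : 0 < 2 * (y + h))).eventually_gt_atTop _
  obtain ⟨R, hR0, hR1, hR2⟩ := ((eventually_gt_atTop 0).and (h1.and h2)).exists
  refine ⟨R, hR0, by nlinarith, ?_⟩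
  rw [dist_eq_norm, ← sq_lt_sq₀ (norm_nonneg _) hR0.le, ← Complex.normSq_eq_norm_sq,
    Complex.normSq_apply]
  simp
  change x * x + (y - (R - h)) * (y - (R - h)) < R ^ 2
  nlinarith

/-- Minkowski's inequality on `(0,1)`, a probability space, where constants equal their own `L²`
norm. -/
theorem le_of_forall_le_norm_add_one {h : ℝ} (hh : 0 < h) {f : HolSpace (halfPlane h)} {M k : ℝ}
    (hM : 0 ≤ M) (hf : normL2 hh f ≤ ENNReal.ofReal M)
    (hk : ∀ x ∈ Set.Ioo (0 : ℝ) 1, k ≤ ‖f.1 (realPoint hh x) + 1‖) : k ≤ M + 1 := by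
  rcases le_or_gt k 0 with hk0 | hk0
  · linarith
  have hcont : Continuous fun x : ℝ => f.1 (realPoint hh x) :=
    f.1.continuous.comp (Complex.continuous_ofReal.subtype_mk _)
  set μ := volume.restrict (Set.Ioo (0 : ℝ) 1) with hμ
  have : IsProbabilityMeasure μ := ⟨by simp [hμ]⟩
  have h1 : eLpNorm (fun _ : ℝ => k) 2 μ ≤ eLpNorm (fun x => f.1 (realPoint hh x) + 1) 2 μ := by
    refine eLpNorm_mono_ae ?_
    filter_upwards [ae_restrict_mem measurableSet_Ioo] with x hx
    rw [Real.norm_of_nonneg hk0.le]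
    exact hk x hx
  have h2 : eLpNorm (fun x => f.1 (realPoint hh x) + 1) 2 μ ≤
      normL2 hh f + eLpNorm (fun _ : ℝ => (1 : ℂ)) 2 μ :=
    eLpNorm_add_le hcont.aestronglyMeasurable aestronglyMeasurable_const (by norm_num)
  have h3 : ENNReal.ofReal k ≤ ENNReal.ofReal (M + 1) := by
    rw [ENNReal.ofReal_add hM zero_le_one, ENNReal.ofReal_one]
    have h4 := h1.trans (h2.trans (add_le_add_left hf _))
    rw [eLpNorm_const _ two_ne_zero (IsProbabilityMeasure.ne_zero μ),
      eLpNorm_const _ two_ne_zero (IsProbabilityMeasure.ne_zero μ)] at h4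
    simpa [Real.enorm_of_nonneg hk0.le] using h4
  exact (ENNReal.ofReal_le_ofReal_iff (by linarith)).1 h3

/-- An `L²(0,1)` bound implies local bounds on `stieltjesClass h`. -/
theorem exists_local_bound {h : ℝ} (hh : 0 < h) {M : ℝ} (hM : 0 ≤ M) (ω₀ : halfPlane h) :
    ∃ C δ : ℝ, 0 < δ ∧ ∀ f ∈ stieltjesClass h, normL2 hh f ≤ ENNReal.ofReal M →
      ∀ ω : halfPlane h, dist (ω : ℂ) ω₀ < δ → ‖f.1 ω‖ ≤ C := by
  obtain ⟨R, hR, hR1, hR2⟩ := exists_radius hh ω₀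
  set c : ℂ := Complex.I * ((R - h : ℝ) : ℂ) with hc
  -- The disc of radius `ρ R` reaches the point `1` (first entry) and covers the `δ`-ball about `ω₀`
  -- (second entry).
  set ρ : ℝ := max (Real.sqrt (1 + (R - h) ^ 2)) ((R + dist (ω₀ : ℂ) c) / 2) / R with hρdef
  have hρR : ρ * R = max (Real.sqrt (1 + (R - h) ^ 2)) ((R + dist (ω₀ : ℂ) c) / 2) :=
    div_mul_cancel₀ _ hR.ne'
  have hρ1 : ρ < 1 := by
    rw [hρdef, div_lt_one hR]
    exact max_lt ((Real.sqrt_lt' hR).2 hR1) (by linarith)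
  have hρ0 : 0 ≤ ρ := div_nonneg (le_max_of_le_left (Real.sqrt_nonneg _)) hR.le
  have hρR' : ρ * R < R := by nlinarith
  set κ : ℝ := (1 - ρ) ^ 2 / (1 + ρ) ^ 2 with hκ
  have hκ0 : 0 < κ := div_pos (pow_pos (by linarith) 2) (by positivity)
  have hball : Metric.ball c R ⊆ halfPlane h := fun ω hω => by
    have h1 : |(ω - c).im| < R := (Complex.abs_im_le_norm _).trans_lt (mem_ball_iff_norm.1 hω)
    have h2 := (abs_lt.1 h1).1
    simp [hc] at h2
    change -h < ω.im
    linarith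
  -- One factor `κ` is lost from `(0,1)` to the centre, one from the centre to `ω`; the final `1`
  -- undoes the shift `f + 1`.
  refine ⟨(M + 1) / κ / κ + 1, (R - dist (ω₀ : ℂ) c) / 2, by linarith,
    fun f hf hfM ω hω => ?_⟩
  have hcone := stieltjesClass_subset_passiveCone h hf
  obtain ⟨F, hF, hfF⟩ := hf
  obtain ⟨g, hg, hfg⟩ := f.2
  have hcmem : c ∈ halfPlane h := hball (Metric.mem_ball_self hR)
  have hcre : ((⟨c, hcmem⟩ : halfPlane h) : ℂ).re = 0 := by simp [hc]
  have hcr := hcone.2.2 ⟨c, hcmem⟩ hcre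
  have hci := hcone.1 ⟨c, hcmem⟩
  rw [reflect_of_re_eq_zero hcre, Complex.conj_eq_iff_im] at hci
  rw [hfg] at hcr hci
  have ha : 0 < (g c).re + 1 := by linarith
  have hslit : Set.MapsTo (fun w => g w + 1) (Metric.ball c R) Complex.slitPlane := fun w hw => by
    have := hF.add_mem_slitPlane one_pos (shift_sq_mem_cutPlane ⟨w, hball hw⟩)
    rwa [← hfF, hfg, Complex.ofReal_one] at this
  have hpc : g c + 1 = (((g c).re + 1 : ℝ) : ℂ) := Complex.ext (by simp) (by simp [hci])
  have harnack : ∀ z : ℂ, dist z c ≤ ρ * R →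
      ‖g z + 1‖ * κ ≤ (g c).re + 1 ∧ ((g c).re + 1) * κ ≤ ‖g z + 1‖ := fun z hz => by
    obtain ⟨h1, h2⟩ := harnack_of_mapsTo_slitPlane
      ((hg.differentiableOn.mono hball).add_const 1) hslit ha hpc
      (Metric.mem_ball.2 (hz.trans_lt hρR')) hρ1 hz
    have hpos : 0 < (1 + ρ) ^ 2 := by positivity
    rw [hκ, ← mul_div_assoc, ← mul_div_assoc]
    exact ⟨(div_le_iff₀ hpos).2 h1, (div_le_iff₀ hpos).2 h2⟩
  have hL : ((g c).re + 1) * κ ≤ M + 1 := by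
    refine le_of_forall_le_norm_add_one hh hM hfM fun x hx => ?_
    rw [hfg]
    refine (harnack _ ?_).2
    rw [hρR]
    refine le_max_of_le_left (Real.le_sqrt_of_sq_le ?_)
    rw [dist_eq_norm, ← Complex.normSq_eq_norm_sq, Complex.normSq_apply]
    simp [hc, realPoint]
    nlinarith [hx.1, hx.2]
  have hω' : dist (ω : ℂ) c ≤ ρ * R := by
    rw [hρR]
    refine le_max_of_le_right ?_
    linarith [dist_triangle (ω : ℂ) ω₀ c]
  have h1 := (le_div_iff₀ hκ0).2 (harnack ω hω').1
  have h2 := (le_div_iff₀ hκ0).2 hL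
  rw [hfg]
  calc ‖g ω‖ = ‖(g ω + 1) - 1‖ := by rw [add_sub_cancel_right]
    _ ≤ ‖g ω + 1‖ + 1 := (norm_sub_le _ _).trans_eq (by rw [norm_one])
    _ ≤ (M + 1) / κ / κ + 1 := by
      gcongr
      exact h1.trans (by gcongr)

/-! ### Montel's theorem -/

/-- A locally uniform limit of holomorphic functions is holomorphic. -/
theorem exists_analytic_of_tendsto {G : Set ℂ} (hG : IsOpen G) {u : ℕ → HolSpace G} {f : C(G, ℂ)}
    (hu : Tendsto (fun n => (u n).1) atTop (𝓝 f)) :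
    ∃ g : ℂ → ℂ, AnalyticOnNhd ℂ g G ∧ ∀ z : G, f z = g z := by
  have : LocallyCompactSpace G := hG.locallyCompactSpace
  choose g hg hug using fun n => (u n).2
  classical
  let g' : ℂ → ℂ := fun z => if hz : z ∈ G then f ⟨z, hz⟩ else 0
  have hg' : ∀ z : G, f z = g' z := fun z => by simp [g']
  refine ⟨g', DifferentiableOn.analyticOnNhd ?_ hG, hg'⟩
  have hlim : TendstoLocallyUniformlyOn g g' atTop G := by
    rw [tendstoLocallyUniformlyOn_iff_tendstoLocallyUniformly_comp_coe]
    have h1 := ContinuousMap.tendsto_iff_tendstoLocallyUniformly.1 hu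
    have e1 : (fun n (z : G) => (u n).1 z) = fun n => g n ∘ (Subtype.val : G → ℂ) :=
      funext fun n => funext fun z => hug n z
    have e2 : (f : G → ℂ) = g' ∘ (Subtype.val : G → ℂ) := funext hg'
    rw [← e2]
    rw [e1] at h1
    exact h1
  exact hlim.differentiableOn (Eventually.of_forall fun n => (hg n).differentiableOn) hG

/-- A locally uniformly bounded family of holomorphic functions is equicontinuous. -/
theorem equicontinuous_of_locally_bounded {G : Set ℂ} (hG : IsOpen G) {𝓕 : Set (HolSpace G)}
    (hb : ∀ z₀ : G, ∃ C δ : ℝ, 0 < δ ∧ ∀ f ∈ 𝓕, ∀ z : G, dist (z : ℂ) z₀ < δ → ‖f.1 z‖ ≤ C) :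
    Equicontinuous fun (f : 𝓕) (z : G) => f.1.1 z := by
  intro z₀
  obtain ⟨C, δ, hδ, hC⟩ := hb z₀
  obtain ⟨r', hr', hball'⟩ := Metric.isOpen_iff.1 hG _ z₀.2
  set r := min δ r'
  have hr : 0 < r := lt_min hδ hr'
  have hball : Metric.ball (z₀ : ℂ) r ⊆ G :=
    (Metric.ball_subset_ball (min_le_right _ _)).trans hball'
  refine Metric.equicontinuousAt_of_continuity_modulus
    (fun z : G => (C + C) / r * dist (z : ℂ) z₀) ?_ _ ?_
  · have : Continuous fun z : G => (C + C) / r * dist (z : ℂ) z₀ := by fun_prop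
    simpa using this.tendsto z₀
  · filter_upwards [Metric.ball_mem_nhds z₀ hr] with z hz f
    obtain ⟨g, hg, hfg⟩ := f.1.2
    have hbd : ∀ w ∈ Metric.ball (z₀ : ℂ) r, ‖g w‖ ≤ C := fun w hw => by
      rw [← hfg ⟨w, hball hw⟩]
      exact hC f.1 f.2 _ (lt_of_lt_of_le hw (min_le_left _ _))
    rw [dist_comm, hfg, hfg]
    -- `g` stays within `2C` of `g z₀` on the ball, so the Schwarz lemma gives the slope `2C / r`
    -- uniformly in the family.
    refine Complex.dist_le_div_mul_dist_of_mapsTo_ball (hg.differentiableOn.mono hball)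
      (fun w hw => ?_) hz
    exact (dist_le_norm_add_norm _ _).trans
      (add_le_add (hbd w hw) (hbd _ (Metric.mem_ball_self hr)))

/-- **Montel's theorem**: a locally uniformly bounded family of holomorphic functions is normal. -/
theorem isNormalFamily_of_locally_bounded {G : Set ℂ} (hG : IsOpen G) {𝓕 : Set (HolSpace G)}
    (hb : ∀ z₀ : G, ∃ C δ : ℝ, 0 < δ ∧ ∀ f ∈ 𝓕, ∀ z : G, dist (z : ℂ) z₀ < δ → ‖f.1 z‖ ≤ C) :
    IsNormalFamily 𝓕 := by
  have : LocallyCompactSpace G := hG.locallyCompactSpace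
  have heq : Equicontinuous fun (f : (Subtype.val '' 𝓕 : Set C(G, ℂ))) (z : G) => f.1 z := by
    have h0 := equicontinuous_of_locally_bounded hG hb
    have hmem : ∀ f : (Subtype.val '' 𝓕 : Set C(G, ℂ)), ∃ f' : 𝓕, f'.1.1 = f.1 := fun f => by
      obtain ⟨f', hf', hff⟩ := f.2
      exact ⟨⟨f', hf'⟩, hff⟩
    choose φ hφ using hmem
    have h1 := h0.comp φ
    have : (fun (f : (Subtype.val '' 𝓕 : Set C(G, ℂ))) (z : G) => f.1 z) =
        (fun (f : 𝓕) (z : G) => f.1.1 z) ∘ φ := by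
      funext f z
      simp only [Function.comp, hφ]
    rw [this]
    exact h1
  have hcpt : IsCompact (closure (Subtype.val '' 𝓕 : Set C(G, ℂ))) := by
    have : T2Space (UniformOnFun G ℂ {K : Set G | IsCompact K}) :=
      UniformOnFun.t2Space_of_covering
        (Set.sUnion_eq_univ_iff.2 fun z => ⟨{z}, isCompact_singleton, rfl⟩)
    refine ArzelaAscoli.isCompact_closure_of_isClosedEmbedding
      (𝔖 := {K : Set G | IsCompact K}) (F := fun (f : C(G, ℂ)) (z : G) => f z)
      (fun K hK => hK)
      ContinuousMap.isUniformEmbedding_toUniformOnFunIsCompact.isClosedEmbedding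
      (fun K _ => heq.equicontinuousOn K) fun K _ z _ => ?_
    obtain ⟨C, δ, hδ, hC⟩ := hb z
    refine ⟨Metric.closedBall 0 C, isCompact_closedBall _ _, ?_⟩
    rintro _ ⟨f, hf, rfl⟩
    rw [mem_closedBall_zero_iff]
    exact hC f hf z (by simpa using hδ)
  intro u hu
  -- Compactness holds in `C(G, ℂ)`, so the limit is a priori only continuous; its analyticity is
  -- supplied afterwards.
  obtain ⟨f, -, φ, hφ, hlim⟩ := hcpt.isSeqCompact (x := fun n => (u n).1)
    fun n => subset_closure ⟨u n, hu n, rfl⟩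
  exact ⟨⟨f, exists_analytic_of_tendsto hG (u := u ∘ φ) hlim⟩, φ, hφ, tendsto_subtype_rng.2 hlim⟩

end Permittivity


theorem theorem4p1 (h : ℝ) (hh : 0 < h) :
    closure (Permittivity.admissible h) = Permittivity.stieltjesClass h ∧
    ∀ M : ℝ, 0 < M →
      Permittivity.IsNormalFamily
        {f | f ∈ Permittivity.stieltjesClass h ∧
          Permittivity.normL2 hh f ≤ ENNReal.ofReal M} := by
  refine ⟨Permittivity.closure_admissible h, fun M hM => ?_⟩
  refine Permittivity.isNormalFamily_of_locally_bounded (Permittivity.isOpen_halfPlane h)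
    fun ω₀ => ?_
  obtain ⟨C, δ, hδ, hC⟩ := Permittivity.exists_local_bound hh hM.le ω₀
  exact ⟨C, δ, hδ, fun f hf => hC f hf.1 hf.2⟩
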